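/- A \emph{cartesian closed 2-category} is a strict 2-category $K$ with a terminal object $1$, binary products $A\times B$ and exponentials $A^J$ such that, for all objects $X, A, B, J$, the hom-category $K(X,1)$ is the terminal category and the canonical functors $K(X,A\times B)\to K(X,A)\times K(X,B)$ and $K(X,A^J)\to K(X\times J,A)$ (given by the projections and by $h\mapsto \mathrm{ev}\circ(h\times J)$) are isomorphisms of categories. Write $u^J\colon A^J\to B^J$ for exponentiation of $u\colon A\to B$, and $\Delta\colon A\cong A^1\to A^J$ for exponentiation with $!\colon J\to 1$; then $u^J\Delta=\Delta u$. A pair $(r,\rho)$ with $r\colon C\to B$ and $\rho\colon fr\Rightarrow g$ is an \emph{absolute right lifting} of $g\colon C\to A$ through $f\colon B\to A$ if for all $b\colon X\to B$ and $c\colon X\to C$ pasting with $\rho$, $\beta\mapsto \rho c\cdot f\beta$, is a bijection from 2-cells $b\Rightarrow rc$ to 2-cells $fb\Rightarrow gc$; absolute left liftings $(l,\gamma\colon g\Rightarrow fl)$ are defined dually, by reversing 2-cells. A \emph{limit cone} of a diagram $d\colon 1\to A^J$ is an absolute right lifting $(\ell\colon 1\to A,\ \lambda\colon\Delta\ell\Rightarrow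 d)$ of $d$ through $\Delta$, and a \emph{colimit cone} is an absolute left lifting $(c\colon 1\to A,\ \gamma\colon d\Rightarrow\Delta c)$ of $d$ through $\Delta$. \textbf{Theorem.} Let $K$ be a cartesian closed 2-category, and let $f\colon B\to A$ and $u\colon A\to B$ be 1-cells of $K$ with $f$ left adjoint to $u$. Then for every object $J$: (1) if $(\ell,\lambda)$ is a limit cone of $d\colon 1\to A^J$, then $(u\ell,\ u^J\lambda\colon \Delta u\ell=u^J\Delta\ell\Rightarrow u^Jd)$ is a limit cone of $u^Jd$; (2) if $(c,\gamma)$ is a colimit cone of $d\colon 1\to B^J$, then $(fc,\ f^J\gamma\colon f^Jd\Rightarrow f^J\Delta c=\Delta fc)$ is a colimit cone of $f^Jd$. In particular this holds in the 2-category $\infty\text{-}\mathsf{CAT}$ of $\infty$-categories, in the model whose objects are the quasi-categories, whose 1-cells are the maps of simplicial sets, and whose hom-category from $X$ to $Y$ is the homotopy category of the quasi-category $Y^X$, with products and exponentials those of simplicial sets: right adjoints between $\infty$-categories preserve limits, and left adjoints preserve colimits. -/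

import Mathlib

open CategoryTheory Bicategory

universe t w v u

/-! ### Absolute liftings in a 2-category -/

section Lifting

variable {K : Type u} [Bicategory.{w, v} K] {A B C : K}

/-- `(r, ρ)`, with `ρ : f r ⇒ g`, is an absolute right lifting of `g : C ⟶ A` through `f : B ⟶ A`
(a right adjoint of `f` relative to `g`): for all `b : X ⟶ B` and `c : X ⟶ C`, pasting with `ρ` is a
bijection from 2-cells `β : b ⇒ r c` to 2-cells `α : f b ⇒ g c`.
(Composites are written in diagrammatic order.) -/
def IsAbsoluteRightLifting (f : B ⟶ A) (g : C ⟶ A) (r : C ⟶ B) (ρ : r ≫ f ⟶ g) : Prop :=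
  ∀ ⦃X : K⦄ (b : X ⟶ B) (c : X ⟶ C),
    Function.Bijective fun β : b ⟶ c ≫ r => (β ▷ f ≫ (α_ c r f).hom ≫ c ◁ ρ : b ≫ f ⟶ c ≫ g)

/-- `(l, γ)`, with `γ : g ⇒ f l`, is an absolute left lifting of `g : C ⟶ A` through `f : B ⟶ A`
(a left adjoint of `f` relative to `g`): for all `b : X ⟶ B` and `c : X ⟶ C`, pasting with `γ` is a
bijection from 2-cells `β : l c ⇒ b` to 2-cells `α : g c ⇒ f b`. -/
def IsAbsoluteLeftLifting (f : B ⟶ A) (g : C ⟶ A) (l : C ⟶ B) (γ : g ⟶ l ≫ f) : Prop :=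
  ∀ ⦃X : K⦄ (b : X ⟶ B) (c : X ⟶ C),
    Function.Bijective fun β : c ≫ l ⟶ b => (c ◁ γ ≫ (α_ c l f).inv ≫ β ▷ f : c ≫ g ⟶ b ≫ f)

end Lifting

/-! ### Cartesian closed 2-categories -/

/-- A (strict) 2-category with chosen finite 2-products: a terminal object `one` and binary products
`prod A B`, the hom-category `K(X, one)` being the terminal category, and the functor
`K(X, prod A B) ⥤ K(X, A) × K(X, B)` given by the projections being an isomorphism of categories
(bijective on 1-cells and on 2-cells). -/
class CartesianTwoCategory (K : Type u) [Bicategory.{w, v} K] [Bicategory.Strict K] where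
  one : K
  toOne (X : K) : X ⟶ one
  toOne_unique {X : K} (h : X ⟶ one) : h = toOne X
  toOne_unique₂ {X : K} {h k : X ⟶ one} (θ θ' : h ⟶ k) : θ = θ'
  prod : K → K → K
  fst (A B : K) : prod A B ⟶ A
  snd (A B : K) : prod A B ⟶ B
  pair_bijective (X A B : K) :
    Function.Bijective fun h : X ⟶ prod A B => (h ≫ fst A B, h ≫ snd A B)
  pair₂_bijective {X A B : K} (h k : X ⟶ prod A B) :
    Function.Bijective fun θ : h ⟶ k => (θ ▷ fst A B, θ ▷ snd A B)

namespace CartesianTwoCategory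

variable {K : Type u} [Bicategory.{w, v} K] [Bicategory.Strict K] [CartesianTwoCategory K]

/-- The 1-cell `(p, q) : X ⟶ A × B`. -/
noncomputable def lift {X A B : K} (p : X ⟶ A) (q : X ⟶ B) : X ⟶ prod A B :=
  ((pair_bijective X A B).2 (p, q)).choose

theorem lift_fst {X A B : K} (p : X ⟶ A) (q : X ⟶ B) : lift p q ≫ fst A B = p :=
  congrArg Prod.fst ((pair_bijective X A B).2 (p, q)).choose_spec

theorem lift_snd {X A B : K} (p : X ⟶ A) (q : X ⟶ B) : lift p q ≫ snd A B = q :=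
  congrArg Prod.snd ((pair_bijective X A B).2 (p, q)).choose_spec

theorem prod_hom_ext {X A B : K} {h k : X ⟶ prod A B} (h₁ : h ≫ fst A B = k ≫ fst A B)
    (h₂ : h ≫ snd A B = k ≫ snd A B) : h = k :=
  (pair_bijective X A B).1 (Prod.ext h₁ h₂)

/-- The 2-cell `h ⇒ k` between 1-cells into `A × B` with prescribed components. -/
noncomputable def lift₂ {X A B : K} {h k : X ⟶ prod A B} (α : h ≫ fst A B ⟶ k ≫ fst A B)
    (β : h ≫ snd A B ⟶ k ≫ snd A B) : h ⟶ k :=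
  ((pair₂_bijective h k).2 (α, β)).choose

theorem lift₂_fst {X A B : K} {h k : X ⟶ prod A B} (α : h ≫ fst A B ⟶ k ≫ fst A B)
    (β : h ≫ snd A B ⟶ k ≫ snd A B) : lift₂ α β ▷ fst A B = α :=
  congrArg Prod.fst ((pair₂_bijective h k).2 (α, β)).choose_spec

theorem lift₂_snd {X A B : K} {h k : X ⟶ prod A B} (α : h ≫ fst A B ⟶ k ≫ fst A B)
    (β : h ≫ snd A B ⟶ k ≫ snd A B) : lift₂ α β ▷ snd A B = β :=
  congrArg Prod.snd ((pair₂_bijective h k).2 (α, β)).choose_spec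

/-- The 1-cell `h × J`. -/
noncomputable def prodMap {X Y : K} (h : X ⟶ Y) (J : K) : prod X J ⟶ prod Y J :=
  lift (fst X J ≫ h) (snd X J)

theorem prodMap_fst {X Y : K} (h : X ⟶ Y) (J : K) : prodMap h J ≫ fst Y J = fst X J ≫ h :=
  lift_fst _ _

theorem prodMap_snd {X Y : K} (h : X ⟶ Y) (J : K) : prodMap h J ≫ snd Y J = snd X J :=
  lift_snd _ _

/-- The 2-cell `θ × J : h × J ⇒ k × J`. -/
noncomputable def prodMap₂ {X Y : K} {h k : X ⟶ Y} (θ : h ⟶ k) (J : K) :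
    prodMap h J ⟶ prodMap k J :=
  lift₂ (eqToHom (prodMap_fst h J) ≫ fst X J ◁ θ ≫ eqToHom (prodMap_fst k J).symm)
    (eqToHom ((prodMap_snd h J).trans (prodMap_snd k J).symm))

theorem prodMap₂_fst {X Y : K} {h k : X ⟶ Y} (θ : h ⟶ k) (J : K) :
    prodMap₂ θ J ▷ fst Y J =
      eqToHom (prodMap_fst h J) ≫ fst X J ◁ θ ≫ eqToHom (prodMap_fst k J).symm :=
  lift₂_fst _ _

theorem prodMap₂_snd {X Y : K} {h k : X ⟶ Y} (θ : h ⟶ k) (J : K) :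
    prodMap₂ θ J ▷ snd Y J = eqToHom ((prodMap_snd h J).trans (prodMap_snd k J).symm) :=
  lift₂_snd _ _

end CartesianTwoCategory

section

open CartesianTwoCategory

/-- A cartesian closed 2-category: a 2-category with finite 2-products and with exponentials
`exp J A`, written `A^J`; the functor `K(X, A^J) ⥤ K(X × J, A)`, `h ↦ ev ∘ (h × J)`, is an
isomorphism of categories (bijective on 1-cells and on 2-cells). -/
class CartesianClosedTwoCategory (K : Type u) [Bicategory.{w, v} K] [Bicategory.Strict K] extends
    CartesianTwoCategory K where
  exp : K → K → K
  ev (J A : K) : prod (exp J A) J ⟶ A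
  curry_bijective (X J A : K) :
    Function.Bijective fun h : X ⟶ exp J A => prodMap h J ≫ ev J A
  curry₂_bijective {X J A : K} (h k : X ⟶ exp J A) :
    Function.Bijective fun θ : h ⟶ k => prodMap₂ θ J ▷ ev J A

namespace CartesianClosedTwoCategory

variable {K : Type u} [Bicategory.{w, v} K] [Bicategory.Strict K] [CartesianClosedTwoCategory K]

/-- The transpose `X ⟶ A^J` of a 1-cell `X × J ⟶ A`. -/
noncomputable def curry {X J A : K} (g : prod X J ⟶ A) : X ⟶ exp J A :=
  ((curry_bijective X J A).2 g).choose

theorem prodMap_curry_ev {X J A : K} (g : prod X J ⟶ A) : prodMap (curry g) J ≫ ev J A = g :=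
  ((curry_bijective X J A).2 g).choose_spec

/-- Exponentiation of `u : A ⟶ B` by `J`: the 1-cell `u^J : A^J ⟶ B^J`. -/
noncomputable def expMap {A B : K} (u : A ⟶ B) (J : K) : exp J A ⟶ exp J B :=
  curry (ev J A ≫ u)

/-- Exponentiation with `m : I ⟶ J`: the 1-cell `A^m : A^J ⟶ A^I`. -/
noncomputable def expPre {I J : K} (m : I ⟶ J) (A : K) : exp J A ⟶ exp I A :=
  curry (lift (fst (exp J A) I) (snd (exp J A) I ≫ m) ≫ ev J A)

/-- The constant diagrams 1-cell `Δ : A ≅ A^1 ⟶ A^J`, exponentiation with `! : J ⟶ 1`. -/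
noncomputable def constDiagram (A J : K) : A ⟶ exp J A :=
  curry (fst A one) ≫ expPre (toOne J) A

theorem prodMap_comp {X Y Z : K} (h : X ⟶ Y) (k : Y ⟶ Z) (J : K) :
    prodMap (h ≫ k) J = prodMap h J ≫ prodMap k J := by
  apply prod_hom_ext
  · rw [Strict.assoc]
    simp only [prodMap, lift_fst]
    rw [← Strict.assoc, ← Strict.assoc, lift_fst]
  · rw [Strict.assoc]
    simp only [prodMap, lift_snd]

theorem exp_hom_ext {X J A : K} {h k : X ⟶ exp J A}
    (e : prodMap h J ≫ ev J A = prodMap k J ≫ ev J A) : h = k :=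
  (curry_bijective X J A).1 e

/-- The constant diagrams 1-cell is the transpose of the projection `A × J ⟶ A`. -/
theorem constDiagram_eq (A J : K) : constDiagram A J = curry (fst A J) := by
  apply exp_hom_ext
  rw [prodMap_curry_ev, constDiagram, prodMap_comp, Strict.assoc, expPre, prodMap_curry_ev,
    ← Strict.assoc]
  have : prodMap (curry (fst A one)) J ≫
      lift (fst (exp one A) J) (snd (exp one A) J ≫ toOne J) =
      lift (fst A J) (toOne _) ≫ prodMap (curry (fst A one)) one := by
    apply prod_hom_ext
    · rw [Strict.assoc, Strict.assoc, lift_fst, prodMap, prodMap, lift_fst, lift_fst,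
        ← Strict.assoc, lift_fst]
    · rw [toOne_unique (_ ≫ snd _ one), toOne_unique ((_ ≫ _) ≫ snd _ one)]
  rw [this, Strict.assoc, prodMap_curry_ev, lift_fst]

/-- `u^J Δ = Δ u`. -/
theorem comp_constDiagram {A B : K} (u : A ⟶ B) (J : K) :
    u ≫ constDiagram B J = constDiagram A J ≫ expMap u J := by
  apply exp_hom_ext
  rw [constDiagram_eq, constDiagram_eq, prodMap_comp, prodMap_comp, Strict.assoc, Strict.assoc,
    expMap, prodMap_curry_ev, prodMap_curry_ev, ← Strict.assoc, prodMap_curry_ev, prodMap, lift_fst]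

/-! ### Limits and colimits of diagrams `d : 1 ⟶ A^J` -/

/-- `ℓ : 1 ⟶ A` with the cone `lam : Δ ℓ ⇒ d` is a limit of the diagram `d : 1 ⟶ A^J`. -/
def IsLimitCone {A J : K} (d : one ⟶ exp J A) (ℓ : one ⟶ A) (lam : ℓ ≫ constDiagram A J ⟶ d) :
    Prop :=
  IsAbsoluteRightLifting (constDiagram A J) d ℓ lam

/-- `c : 1 ⟶ A` with the cocone `γ : d ⇒ Δ c` is a colimit of the diagram `d : 1 ⟶ A^J`. -/
def IsColimitCone {A J : K} (d : one ⟶ exp J A) (c : one ⟶ A) (γ : d ⟶ c ≫ constDiagram A J) :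
    Prop :=
  IsAbsoluteLeftLifting (constDiagram A J) d c γ

/-- The image `Δ (u ℓ) = u^J Δ ℓ ⇒ u^J d` under `u : A ⟶ B` of a cone `lam : Δ ℓ ⇒ d`. -/
noncomputable def mapCone {A B J : K} (u : A ⟶ B) {d : one ⟶ exp J A} {ℓ : one ⟶ A}
    (lam : ℓ ≫ constDiagram A J ⟶ d) : (ℓ ≫ u) ≫ constDiagram B J ⟶ d ≫ expMap u J :=
  (α_ ℓ u (constDiagram B J)).hom ≫ ℓ ◁ eqToHom (comp_constDiagram u J) ≫
    (α_ ℓ (constDiagram A J) (expMap u J)).inv ≫ lam ▷ expMap u J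

/-- The image `u^J d ⇒ u^J Δ c = Δ (u c)` under `u : A ⟶ B` of a cocone `γ : d ⇒ Δ c`. -/
noncomputable def mapCocone {A B J : K} (u : A ⟶ B) {d : one ⟶ exp J A} {c : one ⟶ A}
    (γ : d ⟶ c ≫ constDiagram A J) : d ≫ expMap u J ⟶ (c ≫ u) ≫ constDiagram B J :=
  γ ▷ expMap u J ≫ (α_ c (constDiagram A J) (expMap u J)).hom ≫
    c ◁ eqToHom (comp_constDiagram u J).symm ≫ (α_ c u (constDiagram B J)).inv

/-- `u : A ⟶ B` preserves limits: it carries every limit cone over a diagram `d : 1 ⟶ A^J`, of any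
shape `J`, to a limit cone over `u^J d`. -/
def PreservesLimitCones {A B : K} (u : A ⟶ B) : Prop :=
  ∀ (J : K) (d : one ⟶ exp J A) (ℓ : one ⟶ A) (lam : ℓ ≫ constDiagram A J ⟶ d),
    IsLimitCone d ℓ lam → IsLimitCone (d ≫ expMap u J) (ℓ ≫ u) (mapCone u lam)

/-- `u : A ⟶ B` preserves colimits: it carries every colimit cocone under a diagram `d : 1 ⟶ A^J`,
of any shape `J`, to a colimit cocone under `u^J d`. -/
def PreservesColimitCones {A B : K} (u : A ⟶ B) : Prop :=
  ∀ (J : K) (d : one ⟶ exp J A) (c : one ⟶ A) (γ : d ⟶ c ≫ constDiagram A J),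
    IsColimitCone d c γ → IsColimitCone (d ≫ expMap u J) (c ≫ u) (mapCocone u γ)

end CartesianClosedTwoCategory

end


/-! ### The cartesian closed 2-category of `∞`-categories

The objects are the quasi-categories, the 1-cells are the simplicial maps, and the hom-category from
`X` to `Y` is the homotopy category of the simplicial set of maps from `X` to `Y`. The facts below
serve only to show that this 2-category is cartesian closed: products and exponentials are those of
simplicial sets. -/

/-- The 2-category `∞-CAT` of `∞`-categories, in the quasi-category model. (A synonym for `QCat`
that carries only the 2-category structure.) -/
def InftyCat : Type (t + 1) := SSet.QCat.{t}

namespace InftyCat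

open SSet CartesianMonoidalCategory MonoidalCategory

instance : Bicategory.{t, t} InftyCat.{t} := QCat.bicategory
instance : Bicategory.Strict InftyCat.{t} := QCat.strictBicategory

theorem quasicategory_tensor (X Y : SSet.{t}) [Quasicategory X] [Quasicategory Y] :
    Quasicategory (X ⊗ Y) where
  hornFilling' n i σ h0 hn := by
    obtain ⟨a, ha⟩ := Quasicategory.hornFilling h0 hn (σ ≫ fst X Y)
    obtain ⟨b, hb⟩ := Quasicategory.hornFilling h0 hn (σ ≫ snd X Y)
    exact ⟨CartesianMonoidalCategory.lift a b, by
      apply CartesianMonoidalCategory.hom_ext <;> simp [ha, hb]⟩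

theorem quasicategory_unit : Quasicategory (𝟙_ SSet.{t}) where
  hornFilling' _ _ _ _ _ := ⟨toUnit _, toUnit_unique _ _⟩

/-- The underlying simplicial set of a quasi-category. -/
abbrev toSSet (X : InftyCat.{t}) : SSet.{t} := ObjectProperty.FullSubcategory.obj X

/-- The simplicial map underlying a 1-cell. -/
abbrev mapSet {X Y : InftyCat.{t}} (f : X ⟶ Y) : X.toSSet ⟶ Y.toSSet :=
  InducedCategory.Hom.hom f

/-- The 1-cell given by a simplicial map. -/
def ofMap {X Y : InftyCat.{t}} (f : X.toSSet ⟶ Y.toSSet) : X ⟶ Y :=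
  InducedCategory.homMk f

/-- The simplicial set of maps. -/
abbrev sh (X Y : SSet.{t}) : SSet.{t} := EnrichedCategory.Hom (V := SSet.{t}) X Y
/-- Postcomposition with `g`. -/
abbrev post (X : SSet.{t}) {Y Z : SSet.{t}} (g : Y ⟶ Z) : sh X Y ⟶ sh X Z := eHomWhiskerLeft SSet.{t} X g
/-- Precomposition with `g`. -/
abbrev pre {X Y : SSet.{t}} (g : X ⟶ Y) (Z : SSet.{t}) : sh Y Z ⟶ sh X Z := eHomWhiskerRight SSet.{t} g Z

/-- The hom-category, with objects `pt f` and morphisms `base θ`. -/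
abbrev ho (X Y : InftyCat.{t}) : Cat.{t,t} := hoFunctor.obj (sh X.toSSet Y.toSSet)

theorem lax_right {V W : Type*} [Category* V] [Category* W] [MonoidalCategory V]
    [MonoidalCategory W] (F : V ⥤ W) [F.LaxMonoidal] {S T U : V} (f : 𝟙_ V ⟶ T) (c : S ⊗ T ⟶ U) :
    (ρ_ (F.obj S)).inv ≫ F.obj S ◁ (Functor.LaxMonoidal.ε F ≫ F.map f) ≫
      Functor.LaxMonoidal.μ F S T ≫ F.map c = F.map ((ρ_ S).inv ≫ S ◁ f ≫ c) := by
  simp [← Functor.LaxMonoidal.right_unitality_inv_assoc]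

theorem lax_left {V W : Type*} [Category* V] [Category* W] [MonoidalCategory V]
    [MonoidalCategory W] (F : V ⥤ W) [F.LaxMonoidal] {S T U : V} (f : 𝟙_ V ⟶ S) (c : S ⊗ T ⟶ U) :
    (λ_ (F.obj T)).inv ≫ (Functor.LaxMonoidal.ε F ≫ F.map f) ▷ F.obj T ≫
      Functor.LaxMonoidal.μ F S T ≫ F.map c = F.map ((λ_ T).inv ≫ f ▷ T ≫ c) := by
  simp [← Functor.LaxMonoidal.left_unitality_inv_assoc]

theorem post_cat (X Y Z : QCat.{t}) (g : Y ⟶ Z) :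
    eHomWhiskerLeft Cat X g = hoFunctor.map (post X.obj g.hom) :=
  lax_right hoFunctor (eHomEquiv SSet g.hom) (eComp SSet X.obj Y.obj Z.obj)

theorem pre_cat {X Y : QCat.{t}} (g : X ⟶ Y) (Z : QCat.{t}) :
    eHomWhiskerRight Cat g Z = hoFunctor.map (pre g.hom Z.obj) :=
  lax_left hoFunctor (eHomEquiv SSet g.hom) (eComp SSet X.obj Y.obj Z.obj)

/-- The object of the hom-category given by a 1-cell. -/
abbrev pt {X Y : InftyCat.{t}} (f : X ⟶ Y) : ho X Y :=
  CatEnrichedOrdinary.homEquiv (C := QCat.{t}) f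

/-- The morphism of the hom-category given by a 2-cell. -/
def base {X Y : InftyCat.{t}} {f g : X ⟶ Y} (θ : f ⟶ g) : pt f ⟶ pt g :=
  CatEnrichedOrdinary.Hom.base (C := QCat.{t}) θ

theorem base_bijective {X Y : InftyCat.{t}} (f g : X ⟶ Y) :
   Function.Bijective (base : (f ⟶ g) → (pt f ⟶ pt g)) :=
  ⟨fun _ _ h => CatEnrichedOrdinary.Hom.ext (C := QCat.{t}) _ _ h,
   fun α => ⟨CatEnrichedOrdinary.Hom.mk (C := QCat.{t}) α, rfl⟩⟩

theorem base_eqToHom {X Y : InftyCat.{t}} {f g : X ⟶ Y} (h : f = g) :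
   base (eqToHom h) = eqToHom (by rw [h]) := by subst h; rfl
theorem base_comp {X Y : InftyCat.{t}} {f g h : X ⟶ Y} (α : f ⟶ g) (β : g ⟶ h) :
   base (α ≫ β) = base α ≫ base β := rfl

theorem pt_post {X Y Z : InftyCat.{t}} (f : X ⟶ Y) (g : Y ⟶ Z) :
    pt (f ≫ g) = (hoFunctor.map (post X.toSSet (mapSet g))).toFunctor.obj (pt f) := by
  rw [← post_cat X Y Z g]
  exact CatEnrichedOrdinary.homEquiv_comp (C := QCat.{t}) f g
theorem pt_pre {X Y Z : InftyCat.{t}} (f : X ⟶ Y) (g : Y ⟶ Z) :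
    pt (f ≫ g) = (hoFunctor.map (pre (mapSet f) Z.toSSet)).toFunctor.obj (pt g) := by
  rw [← pre_cat (X := X) (Y := Y) f Z]
  exact CatEnrichedOrdinary.homEquiv_comp (C := QCat.{t}) f g

theorem base_post {X Y Z : InftyCat.{t}} {f f' : X ⟶ Y} (θ : f ⟶ f') (g : Y ⟶ Z) :
    base (θ ▷ g) = eqToHom (pt_post f g) ≫
      (hoFunctor.map (post X.toSSet (mapSet g))).toFunctor.map (base θ) ≫
      eqToHom (pt_post f' g).symm := by
  have := Functor.congr_hom (congrArg Cat.Hom.toFunctor (post_cat X Y Z g).symm) (base θ)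
  rw [this]
  simp only [Category.assoc, eqToHom_trans, eqToHom_trans_assoc]
  rfl
theorem base_pre {X Y Z : InftyCat.{t}} (f : X ⟶ Y) {g g' : Y ⟶ Z} (θ : g ⟶ g')  :
    base (f ◁ θ) = eqToHom (pt_pre f g) ≫
      (hoFunctor.map (pre (mapSet f) Z.toSSet)).toFunctor.map (base θ) ≫
      eqToHom (pt_pre f g').symm := by
  have := Functor.congr_hom (congrArg Cat.Hom.toFunctor (pre_cat (X := X) (Y := Y) f Z).symm) (base θ)
  rw [this]
  simp only [Category.assoc, eqToHom_trans, eqToHom_trans_assoc]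
  rfl


theorem heq_base_post {X Y Z : InftyCat.{t}} {f f' : X ⟶ Y} (θ : f ⟶ f') (g : Y ⟶ Z) :
    base (θ ▷ g) ≍ (hoFunctor.map (post X.toSSet (mapSet g))).toFunctor.map (base θ) := by
  rw [base_post]; simp

theorem heq_base_pre {X Y Z : InftyCat.{t}} (f : X ⟶ Y) {g g' : Y ⟶ Z} (θ : g ⟶ g') :
    base (f ◁ θ) ≍ (hoFunctor.map (pre (mapSet f) Z.toSSet)).toFunctor.map (base θ) := by
  rw [base_pre]; simp

/-- The simplicial map `h ↦ h × J`. -/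
def sprod (X J Y : SSet.{t}) : sh X Y ⟶ sh (X ⊗ J) (Y ⊗ J) where
  app n := TypeCat.ofHom fun a =>
    ({ app := fun c φ => a.app c φ ▷ J.obj c
       naturality := fun {c d} f φ => by
        ext ⟨x, j⟩
        have e := ConcreteCategory.congr_hom (a.naturality f φ) x
        exact Prod.ext e rfl } :
      Functor.HomObj (X ⊗ J) (Y ⊗ J) _)
  naturality := by intros; rfl

/-- Maps into a product of simplicial sets are pairs of maps. -/
def pairIso (X A B : SSet.{t}) : sh X (A ⊗ B) ≅ sh X A ⊗ sh X B where
  hom := CartesianMonoidalCategory.lift (post X (fst A B)) (post X (snd A B))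
  inv := { app := fun n => TypeCat.ofHom fun p =>
            ({app := fun c φ => CartesianMonoidalCategory.lift (p.1.app c φ) (p.2.app c φ)
              naturality := fun {c d} f φ => by
                ext x
                have e₁ := ConcreteCategory.congr_hom (p.1.naturality f φ) x
                have e₂ := ConcreteCategory.congr_hom (p.2.naturality f φ) x
                exact Prod.ext e₁ e₂ } : Functor.HomObj X (A ⊗ B) _)
           naturality := by intros; rfl }
  hom_inv_id := by ext; rfl
  inv_hom_id := by ext <;> rfl

/-- Evaluation of the exponential `A^J` of simplicial sets. -/
def sev (J A : SSet.{t}) : (ihom J).obj A ⊗ J ⟶ A := (β_ _ _).hom ≫ (ihom.ev J).app A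

/-- Transposition of simplicial maps, an isomorphism of simplicial sets of maps. -/
def expIso (X J A : SSet.{t}) : sh X ((ihom J).obj A) ≅ sh (X ⊗ J) A where
  hom := sprod X J _ ≫ post (X ⊗ J) (sev J A)
  inv := { app := fun n => TypeCat.ofHom fun b =>
            ({app := fun c φ => TypeCat.ofHom fun x =>
                ({ app := fun d ψ => TypeCat.ofHom fun j => b.app d (φ ≫ ψ) (X.map ψ x, j)
                   naturality := fun {d d'} g ψ => by
                    ext j
                    have e := ConcreteCategory.congr_hom (b.naturality g (φ ≫ ψ))
                      (show (X ⊗ J).obj d from ((X.map ψ x, j) : X.obj d × J.obj d))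
                    have e' : b.app d' (φ ≫ ψ ≫ g) (X.map (ψ ≫ g) x, J.map g j) =
                      b.app d' ((φ ≫ ψ) ≫ g) (X.map g (X.map ψ x), J.map g j) := by
                      rw [Category.assoc, X.map_comp]; rfl
                    exact e'.trans e } : Functor.HomObj J A _)
              naturality := fun {c d} f φ => by
                ext x
                refine Functor.functorHom_ext fun Y ψ => ?_
                ext j
                have e' : b.app Y ((φ ≫ f) ≫ ψ) (X.map ψ (X.map f x), j) =
                      b.app Y (φ ≫ f ≫ ψ) (X.map (f ≫ ψ) x, j) := by
                      rw [Category.assoc, X.map_comp]; rfl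
                exact e' } : Functor.HomObj X ((ihom J).obj A) _)
           naturality := fun n m f => by
            ext b
            refine Functor.functorHom_ext fun c φ => ?_
            ext x
            refine Functor.functorHom_ext fun d ψ => ?_
            ext j
            have e' : b.app d (f ≫ φ ≫ ψ) (X.map ψ x, j) =
                      b.app d ((f ≫ φ) ≫ ψ) (X.map ψ x, j) := by
                      rw [Category.assoc]
            exact e' }
  hom_inv_id := by
    ext n a
    refine Functor.functorHom_ext fun c φ => ?_
    ext x
    refine Functor.functorHom_ext fun d ψ => ?_
    ext j
    have e := congrArg (fun z : (sh J A).obj d => z.app d (𝟙 d) j) (ConcreteCategory.congr_hom (a.naturality ψ φ) x)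
    have e' : (a.app c φ x).app d (ψ ≫ 𝟙 d) j = (a.app c φ x).app d ψ j := by rw [Category.comp_id]
    exact e.trans e'
  inv_hom_id := by
    ext n b
    refine Functor.functorHom_ext fun c φ => ?_
    ext ⟨x, j⟩
    have e : b.app c (φ ≫ 𝟙 c) (X.map (𝟙 c) x, j) = b.app c φ (x, j) := by
      rw [Category.comp_id, X.map_id]; rfl
    exact e

theorem bijective_of_isIso_lift {C D E : Cat.{t, t}} (F : C ⟶ D) (G : C ⟶ E)
    [IsIso (CartesianMonoidalCategory.lift F G)] (x y : C) :
    Function.Bijective fun θ : x ⟶ y => (F.toFunctor.map θ, G.toFunctor.map θ) := by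
  have h : (CartesianMonoidalCategory.lift F G).toFunctor.IsEquivalence :=
    (Cat.equivOfIso (asIso (CartesianMonoidalCategory.lift F G))).isEquivalence_functor
  exact ⟨fun a b e => (CartesianMonoidalCategory.lift F G).toFunctor.map_injective e,
    fun p => (CartesianMonoidalCategory.lift F G).toFunctor.map_surjective p⟩

theorem bijective_of_isIso {C D : Cat.{t, t}} (F : C ⟶ D) [IsIso F] (x y : C) :
    Function.Bijective fun θ : x ⟶ y => F.toFunctor.map θ := by
  have h : F.toFunctor.IsEquivalence := (Cat.equivOfIso (asIso F)).isEquivalence_functor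
  exact ⟨fun a b e => F.toFunctor.map_injective e, fun p => F.toFunctor.map_surjective p⟩

theorem isIso_lift_ho (X A B : SSet.{t}) :
    IsIso (CartesianMonoidalCategory.lift (hoFunctor.map (post X (fst A B)))
      (hoFunctor.map (post X (snd A B)))) := by
  have h : CartesianMonoidalCategory.lift (hoFunctor.map (post X (fst A B)))
      (hoFunctor.map (post X (snd A B))) =
      hoFunctor.map (pairIso X A B).hom ≫ prodComparison hoFunctor _ _ := by
    apply CartesianMonoidalCategory.hom_ext <;>
      simp [← Functor.map_comp, pairIso]
  rw [h]
  infer_instance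

theorem bijective_conj {C : Type*} [Category* C] {x x' y y' : C} (h : x' = x) (k : y = y') :
    Function.Bijective fun θ : x ⟶ y => eqToHom h ≫ θ ≫ eqToHom k := by
  subst h k
  simpa using! Function.bijective_id

theorem comp_eq {X Y Z : InftyCat.{t}} (f : X ⟶ Y) (g : Y ⟶ Z) :
    mapSet (f ≫ g) = mapSet f ≫ mapSet g := rfl

theorem map_ext {X Y : InftyCat.{t}} {f g : X ⟶ Y} (h : mapSet f = mapSet g) : f = g :=
  InducedCategory.hom_ext h

/-- The terminal quasi-category. -/
abbrev terminalObj : InftyCat.{t} := (⟨𝟙_ SSet, quasicategory_unit⟩ : QCat.{t})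
/-- The product of quasi-categories. -/
abbrev prodObj (X Y : InftyCat.{t}) : InftyCat.{t} :=
  (⟨X.toSSet ⊗ Y.toSSet,
      have : Quasicategory X.toSSet := ObjectProperty.FullSubcategory.property X
      have : Quasicategory Y.toSSet := ObjectProperty.FullSubcategory.property Y
      quasicategory_tensor _ _⟩ : QCat.{t})
/-- The quasi-category `A^J` of `J`-shaped diagrams in `A`. -/
abbrev expObj (J A : InftyCat.{t}) : InftyCat.{t} :=
  (⟨(ihom J.toSSet).obj A.toSSet,
      have : Quasicategory A.toSSet := ObjectProperty.FullSubcategory.property A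
      inferInstance⟩ : QCat.{t})

theorem chosenTerminal_subsingleton {x y : (𝟙_ Cat.{t, t} : Cat.{t, t})} (θ θ' : x ⟶ y) :
    θ = θ' := by
  obtain ⟨⟨⟨θ⟩⟩⟩ := θ
  obtain ⟨⟨⟨θ'⟩⟩⟩ := θ'
  rfl

theorem ho_unit_subsingleton {x y : hoFunctor.obj (𝟙_ SSet.{t})} (θ θ' : x ⟶ y) :
    θ = θ' := by
  have h := bijective_of_isIso (inv (Functor.LaxMonoidal.ε hoFunctor.{t})) x y
  exact h.1 (chosenTerminal_subsingleton _ _)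

theorem ho_unit_obj {x y : hoFunctor.obj (𝟙_ SSet.{t})} : x = y :=
  (hoFunctor.obj.equiv _).injective (Subsingleton.elim (α := PUnit) _ _)

theorem heq_map {C D : Cat.{t, t}} (F : C ⟶ D) {x x' y y' : C} (hx : x = x') (hy : y = y')
    {θ : x ⟶ y} {θ' : x' ⟶ y'} (h : θ ≍ θ') : F.toFunctor.map θ ≍ F.toFunctor.map θ' := by
  subst hx hy; cases h; rfl

theorem heq_map_comp {S T U : SSet.{t}} (p : S ⟶ T) (q : T ⟶ U) (r : S ⟶ U) (hr : p ≫ q = r)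
    {x y : hoFunctor.obj S} (θ : x ⟶ y) :
    (hoFunctor.map r).toFunctor.map θ ≍
      (hoFunctor.map q).toFunctor.map ((hoFunctor.map p).toFunctor.map θ) := by
  subst hr
  rw [hoFunctor.map_comp]
  rfl

theorem heq_map_eqToHom {C D : Cat.{t, t}} (F : C ⟶ D) {x y : C} (e : x = y) (θ : x ⟶ y)
    (h : θ = eqToHom e) {z w : D} (e' : z = w) (hz : F.toFunctor.obj x = z) :
    F.toFunctor.map θ ≍ eqToHom e' := by
  subst e e' hz h
  simp

theorem isIso_toUnit (X : SSet.{t}) : IsIso (toUnit (sh X (𝟙_ SSet.{t}))) :=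
  ⟨eHomEquiv SSet (toUnit X), by ext n a; exact Functor.functorHom_ext fun c φ => by ext; rfl,
    toUnit_unique _ _⟩

theorem pt_sprod {X Y : InftyCat.{t}} (h : X ⟶ Y) (J : InftyCat.{t}) :
    pt (ofMap (mapSet h ▷ J.toSSet) : prodObj X J ⟶ prodObj Y J) =
      (hoFunctor.map (sprod X.toSSet J.toSSet Y.toSSet)).toFunctor.obj (pt h) := rfl

theorem sprod_fst (X J Y : SSet.{t}) : sprod X J Y ≫ post _ (fst Y J) = pre (fst X J) Y := rfl
theorem sprod_snd (X J Y : SSet.{t}) : sprod X J Y ≫ post _ (snd Y J) =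
  toUnit _ ≫ eHomEquiv SSet (snd X J) := rfl

noncomputable instance :  CartesianTwoCategory InftyCat.{t} where
  one := terminalObj
  toOne X := ofMap (toUnit X.toSSet)
  toOne_unique h := map_ext (toUnit_unique _ _)
  toOne_unique₂ {X h k} θ θ' := by
    have := isIso_toUnit X.toSSet
    have h₁ := bijective_of_isIso (hoFunctor.map (toUnit (sh X.toSSet (𝟙_ SSet.{t})))) (pt h) (pt k)
    exact (base_bijective h k).1 (h₁.1 (ho_unit_subsingleton _ _))
  prod := prodObj
  fst A B := ofMap (fst A.toSSet B.toSSet)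
  snd A B := ofMap (snd A.toSSet B.toSSet)
  pair_bijective X A B := by
    refine ⟨fun h k e => map_ext ?_, fun p => ⟨ofMap (CartesianMonoidalCategory.lift (mapSet p.1) (mapSet p.2)), ?_⟩⟩
    · apply CartesianMonoidalCategory.hom_ext
      · exact congrArg (fun z => mapSet z.1) e
      · exact congrArg (fun z => mapSet z.2) e
    · apply Prod.ext <;> apply map_ext
      · exact CartesianMonoidalCategory.lift_fst _ _
      · exact CartesianMonoidalCategory.lift_snd _ _
  pair₂_bijective {X A B} h k := by
    have := isIso_lift_ho X.toSSet A.toSSet B.toSSet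
    have h₁ := (bijective_of_isIso_lift (hoFunctor.map (post X.toSSet (fst A.toSSet B.toSSet)))
      (hoFunctor.map (post X.toSSet (snd A.toSSet B.toSSet))) (pt h) (pt k)).comp (base_bijective h k)
    have h₂ := ((bijective_conj (pt_post h (ofMap (fst A.toSSet B.toSSet) : prodObj A B ⟶ A))
       (pt_post k (ofMap (fst A.toSSet B.toSSet) : prodObj A B ⟶ A)).symm).prodMap
        (bijective_conj (pt_post h (ofMap (snd A.toSSet B.toSSet) : prodObj A B ⟶ B))
       (pt_post k (ofMap (snd A.toSSet B.toSSet) : prodObj A B ⟶ B)).symm)).comp h₁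
    have h₃ := (base_bijective (h ≫ (ofMap (fst A.toSSet B.toSSet) : prodObj A B ⟶ A))
       (k ≫ (ofMap (fst A.toSSet B.toSSet) : prodObj A B ⟶ A))).prodMap
       (base_bijective (h ≫ (ofMap (snd A.toSSet B.toSSet) : prodObj A B ⟶ B))
       (k ≫ (ofMap (snd A.toSSet B.toSSet) : prodObj A B ⟶ B)))
    refine (Function.Bijective.of_comp_iff' h₃ _).1 ?_
    convert h₂ using 1
    funext θ
    exact Prod.ext (base_post θ _) (base_post θ _)


theorem mapSet_prodMap {X Y : InftyCat.{t}} (h : X ⟶ Y) (J : InftyCat.{t}) :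
    CartesianTwoCategory.prodMap h J = (ofMap (mapSet h ▷ J.toSSet) : prodObj X J ⟶ prodObj Y J) := by
  apply CartesianTwoCategory.prod_hom_ext
  · exact CartesianTwoCategory.lift_fst _ _
  · exact CartesianTwoCategory.lift_snd _ _

theorem pt_prodMap {X Y : InftyCat.{t}} (h : X ⟶ Y) (J : InftyCat.{t}) :
    pt (CartesianTwoCategory.prodMap h J) =
      (hoFunctor.map (sprod X.toSSet J.toSSet Y.toSSet)).toFunctor.obj (pt h) := by
  rw [mapSet_prodMap]; rfl

theorem base_prodMap₂ {X Y : InftyCat.{t}} {h k : X ⟶ Y} (θ : h ⟶ k) (J : InftyCat.{t}) :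
    base (CartesianTwoCategory.prodMap₂ θ J) = eqToHom (pt_prodMap h J) ≫
      (hoFunctor.map (sprod X.toSSet J.toSSet Y.toSSet)).toFunctor.map (base θ) ≫
      eqToHom (pt_prodMap k J).symm := by
  obtain ⟨ω, hω⟩ := (base_bijective (CartesianTwoCategory.prodMap h J)
    (CartesianTwoCategory.prodMap k J)).2 (eqToHom (pt_prodMap h J) ≫
      (hoFunctor.map (sprod X.toSSet J.toSSet Y.toSSet)).toFunctor.map (base θ) ≫
      eqToHom (pt_prodMap k J).symm)
  rw [← hω]
  have hω' : base ω ≍ (hoFunctor.map (sprod X.toSSet J.toSSet Y.toSSet)).toFunctor.map (base θ) := by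
    rw [hω]; simp
  congr 1
  apply (CartesianTwoCategory.pair₂_bijective _ _).1
  apply Prod.ext
  · dsimp only
    rw [CartesianTwoCategory.prodMap₂_fst]
    apply (base_bijective _ _).1
    apply eq_of_heq
    refine HEq.trans ?_ (heq_base_post ω (ofMap (fst Y.toSSet J.toSSet) : prodObj Y J ⟶ Y)).symm
    refine HEq.trans ?_ (heq_map _ (pt_prodMap h J) (pt_prodMap k J) hω').symm
    refine HEq.trans ?_ (heq_map_comp _ _ _ (sprod_fst X.toSSet J.toSSet Y.toSSet) (base θ))
    refine HEq.trans ?_ (heq_base_pre (ofMap (fst X.toSSet J.toSSet) : prodObj X J ⟶ X) θ)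
    rw [base_comp, base_comp, base_eqToHom, base_eqToHom]
    simp
    rfl
  · dsimp only
    rw [CartesianTwoCategory.prodMap₂_snd]
    apply (base_bijective _ _).1
    apply eq_of_heq
    refine HEq.trans ?_ (heq_base_post ω (ofMap (snd Y.toSSet J.toSSet) : prodObj Y J ⟶ J)).symm
    refine HEq.trans ?_ (heq_map _ (pt_prodMap h J) (pt_prodMap k J) hω').symm
    refine HEq.trans ?_ (heq_map_comp _ _ _ (sprod_snd X.toSSet J.toSSet Y.toSSet) (base θ))
    refine HEq.trans ?_ (heq_map_comp _ _ _ rfl (base θ)).symm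
    rw [base_eqToHom]
    refine (heq_map_eqToHom _ ho_unit_obj _ (ho_unit_subsingleton _ _) _ ?_).symm
    rw [CartesianTwoCategory.prodMap_snd]
    rfl

theorem heq_base_prodMap₂ {X Y : InftyCat.{t}} {h k : X ⟶ Y} (θ : h ⟶ k) (J : InftyCat.{t}) :
    base (CartesianTwoCategory.prodMap₂ θ J) ≍
      (hoFunctor.map (sprod X.toSSet J.toSSet Y.toSSet)).toFunctor.map (base θ) := by
  rw [base_prodMap₂]; simp

theorem pt_injective {X Y : InftyCat.{t}} : Function.Injective (pt (X := X) (Y := Y)) :=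
  (CatEnrichedOrdinary.homEquiv (C := QCat.{t})).injective
theorem pt_surjective {X Y : InftyCat.{t}} : Function.Surjective (pt (X := X) (Y := Y)) :=
  (CatEnrichedOrdinary.homEquiv (C := QCat.{t})).surjective

theorem bijective_of_iso_ho {S T : SSet.{t}} (i : S ≅ T) :
    Function.Bijective (hoFunctor.map i.hom).toFunctor.obj :=
  Function.bijective_iff_has_inverse.2 ⟨(hoFunctor.map i.inv).toFunctor.obj,
    fun x => congrArg (fun F => Cat.Hom.toFunctor F |>.obj x) (hoFunctor.mapIso i).hom_inv_id,
    fun x => congrArg (fun F => Cat.Hom.toFunctor F |>.obj x) (hoFunctor.mapIso i).inv_hom_id⟩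

noncomputable instance : CartesianClosedTwoCategory InftyCat.{t} where
  exp := expObj
  ev J A := (ofMap (sev J.toSSet A.toSSet) : prodObj (expObj J A) J ⟶ A)
  curry_bijective X J A := by
    have h₁ := (bijective_of_iso_ho (expIso X.toSSet J.toSSet A.toSSet))
    constructor
    · intro h k e
      apply pt_injective
      apply h₁.1
      have := congrArg pt e
      dsimp only at this
      rw [pt_post, pt_post, pt_prodMap, pt_prodMap] at this
      simp only [expIso, Functor.map_comp]
      exact this
    · intro g
      obtain ⟨z, hz⟩ := h₁.2 (pt g)
      obtain ⟨h, rfl⟩ := pt_surjective (X := X) (Y := expObj J A) z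
      refine ⟨h, pt_injective ?_⟩
      rw [← hz, pt_post, pt_prodMap]
      simp only [expIso, Functor.map_comp]
      rfl
  curry₂_bijective {X J A} h k := by
    have h₁ := (bijective_of_isIso (hoFunctor.map (expIso X.toSSet J.toSSet A.toSSet).hom)
      (pt h) (pt k)).comp (base_bijective h k)
    have e : ∀ h : X ⟶ expObj J A, pt (CartesianTwoCategory.prodMap h J ≫
        (ofMap (sev J.toSSet A.toSSet) : prodObj (expObj J A) J ⟶ A)) =
        (hoFunctor.map (expIso X.toSSet J.toSSet A.toSSet).hom).toFunctor.obj (pt h) := by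
      intro h
      rw [pt_post, pt_prodMap]
      simp only [expIso, Functor.map_comp]
      rfl
    have h₂ := (bijective_conj (e h) (e k).symm).comp h₁
    refine (Function.Bijective.of_comp_iff' (base_bijective _ _) _).1 ?_
    convert h₂ using 1
    funext θ
    apply eq_of_heq
    refine (heq_base_post _ _).trans ?_
    refine (heq_map _ (pt_prodMap h J) (pt_prodMap k J) (heq_base_prodMap₂ θ J)).trans ?_
    refine (heq_map_comp _ _ _ rfl (base θ)).symm.trans ?_
    dsimp only [Function.comp_apply]
    simp
    rfl

end InftyCat

/-! Since `K(X, A^J) ≅ K(X × J, A)` on 1-cells and 2-cells, exponentiation by `J` is a 2-functor, so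
`f ⊣ u` yields `f^J ⊣ u^J` with unit `η^J` and counit `ε^J`. For a limit cone `(ℓ, λ)` of `d` and
1-cells `b : X ⟶ B`, `c : X ⟶ 1`, there are bijections between 2-cells `b ⇒ uℓc`, 2-cells `fb ⇒ ℓc`
(transposition along `f ⊣ u`), 2-cells `Δfb ⇒ dc` (pasting with `λ`), 2-cells `f^J Δb ⇒ dc` (as `Δf
= f^J Δ`), and 2-cells `Δb ⇒ u^J dc` (transposition along `f^J ⊣ u^J`).

A bijection alone is not enough: the composite must be pasting with `u^J λ`. This reduces to `ε^J Δ
= Δε`, the naturality of `Δ` in 2-cells. Colimits are dual, with `η^J Δ = Δη`.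

The argument about liftings needs neither products nor exponentials. It is
`IsAbsoluteRightLifting.map_rightAdjoint` and `IsAbsoluteLeftLifting.map_leftAdjoint`, valid in any
bicategory for two adjunctions joined by compatible squares. The cartesian closed structure supplies
their input: `expAdjunction` and `constDiagram_whiskerLeft_expMap₂`. -/

/-! ### Absolute liftings and morphisms of adjunctions -/

section LiftingAdjunction

variable {K : Type u} [Bicategory.{w, v} K] {A B A' B' C : K}
  {f : B ⟶ A} {u : A ⟶ B} {F : B' ⟶ A'} {U : A' ⟶ B'} {p : A ⟶ A'} {q : B ⟶ B'}

/-- Absolute right liftings are carried along a morphism of adjunctions: if the square of right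
adjoints `σ : u q ⇒ p U` is compatible, through the counits, with an invertible square `τ` of left
adjoints, then pasting an absolute right lifting through `p` with `σ` gives one through `q`. -/
theorem IsAbsoluteRightLifting.map_rightAdjoint (adj : f ⊣ u) (adj' : F ⊣ U)
    (σ : u ≫ q ⟶ p ≫ U) (τ : f ≫ p ≅ q ≫ F)
    (h : u ◁ τ.hom ≫ (α_ u q F).inv ≫ σ ▷ F ≫ (α_ p U F).hom ≫ p ◁ adj'.counit ≫ (ρ_ p).hom =
      (α_ u f p).inv ≫ adj.counit ▷ p ≫ (λ_ p).hom)
    {d : C ⟶ A'} {l : C ⟶ A} {lam : l ≫ p ⟶ d} (hl : IsAbsoluteRightLifting p d l lam) :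
    IsAbsoluteRightLifting q (d ≫ U) (l ≫ u)
      ((α_ l u q).hom ≫ l ◁ σ ≫ (α_ l p U).inv ≫ lam ▷ U) := by
  intro X b c
  -- `e₁` transposes along `f ⊣ u`; `e₂` transposes along `F ⊣ U` and then precomposes with `τ`,
  -- which is where invertibility of `τ` is needed.
  let e₁ : (b ⟶ c ≫ l ≫ u) ≃ (b ≫ f ⟶ c ≫ l) :=
    (Iso.homCongr (Iso.refl b) (α_ c l u).symm).trans adj.homEquiv₂.symm
  let e₂ : (b ≫ q ⟶ c ≫ d ≫ U) ≃ ((b ≫ f) ≫ p ⟶ c ≫ d) :=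
    ((Iso.homCongr (Iso.refl _) (α_ c d U).symm).trans adj'.homEquiv₂.symm).trans
      (Iso.homCongr (α_ b q F ≪≫ whiskerLeftIso b τ.symm ≪≫ (α_ b f p).symm) (Iso.refl _))
  -- It suffices that `e₂` after the pasting in question equals pasting with `lam` after `e₁`.
  refine (Function.Bijective.of_comp_iff' e₂.bijective _).1 ?_
  convert (hl (b ≫ f) c).comp e₁.bijective using 1
  funext β
  simp only [e₁, e₂, Function.comp_apply, Equiv.trans_apply, Iso.homCongr_apply,
    Adjunction.homEquiv₂_symm_apply, Iso.refl_inv, Iso.refl_hom, Iso.symm_hom, Iso.trans_inv,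
    Iso.symm_inv, whiskerLeftIso_inv, Category.id_comp, Category.comp_id]
  symm
  calc
    _ = 𝟙 _ ⊗≫ β ▷ f ▷ p ⊗≫ (c ≫ l) ◁ ((α_ u f p).inv ≫ adj.counit ▷ p ≫ (λ_ p).hom) ⊗≫
          c ◁ lam := by bicategory
    -- Compatibility `h` trades the counit of `f ⊣ u` for that of `F ⊣ U`. Two interchanges then
    -- move `β` past `τ` and `lam` past the counit.
    _ = 𝟙 _ ⊗≫ (β ▷ (f ≫ p) ≫ (c ≫ l ≫ u) ◁ τ.hom) ⊗≫ c ◁ l ◁ σ ▷ F ⊗≫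
          c ◁ ((l ≫ p) ◁ adj'.counit ≫ lam ▷ 𝟙 _) ⊗≫ 𝟙 _ := by
      rw [← h]; bicategory
    _ = 𝟙 _ ⊗≫ (b ◁ τ.hom ≫ β ▷ (q ≫ F)) ⊗≫ c ◁ l ◁ σ ▷ F ⊗≫
          c ◁ (lam ▷ (U ≫ F) ≫ d ◁ adj'.counit) ⊗≫ 𝟙 _ := by
      rw [whisker_exchange, whisker_exchange]
    _ = _ := by bicategory

/-- Absolute left liftings are carried along a morphism of adjunctions: if the square of left
adjoints `τ : q F ⇒ f p` is compatible, through the units, with an invertible square `σ` of right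
adjoints, then pasting an absolute left lifting through `q` with `τ` gives one through `p`. -/
theorem IsAbsoluteLeftLifting.map_leftAdjoint (adj : f ⊣ u) (adj' : F ⊣ U)
    (σ : u ≫ q ≅ p ≫ U) (τ : q ≫ F ⟶ f ≫ p)
    (h : (ρ_ q).inv ≫ q ◁ adj'.unit ≫ (α_ q F U).inv ≫ τ ▷ U ≫ (α_ f p U).hom =
      (λ_ q).inv ≫ adj.unit ▷ q ≫ (α_ f u q).hom ≫ f ◁ σ.hom)
    {d : C ⟶ B'} {l : C ⟶ B} {γ : d ⟶ l ≫ q} (hl : IsAbsoluteLeftLifting q d l γ) :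
    IsAbsoluteLeftLifting p (d ≫ F) (l ≫ f)
      (γ ▷ F ≫ (α_ l q F).hom ≫ l ◁ τ ≫ (α_ l f p).inv) := by
  intro X b c
  -- Dually, `e₂` transposes along `F ⊣ U` and then postcomposes with the inverse of `σ`.
  let e₁ : (c ≫ l ≫ f ⟶ b) ≃ (c ≫ l ⟶ b ≫ u) :=
    (Iso.homCongr (α_ c l f).symm (Iso.refl b)).trans adj.homEquiv₂
  let e₂ : (c ≫ d ≫ F ⟶ b ≫ p) ≃ (c ≫ d ⟶ (b ≫ u) ≫ q) :=
    ((Iso.homCongr (α_ c d F).symm (Iso.refl _)).trans adj'.homEquiv₂).trans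
      (Iso.homCongr (Iso.refl _) (α_ b p U ≪≫ whiskerLeftIso b σ.symm ≪≫ (α_ b u q).symm))
  refine (Function.Bijective.of_comp_iff' e₂.bijective _).1 ?_
  convert (hl (b ≫ u) c).comp e₁.bijective using 1
  funext β
  simp only [e₁, e₂, Function.comp_apply, Equiv.trans_apply, Iso.homCongr_apply,
    Adjunction.homEquiv₂_apply, Iso.refl_inv, Iso.refl_hom, Iso.symm_hom, Iso.trans_hom,
    Iso.symm_inv, whiskerLeftIso_hom, Category.id_comp, Category.comp_id]
  calc
    _ = 𝟙 _ ⊗≫ c ◁ (d ◁ adj'.unit ≫ γ ▷ (F ≫ U)) ⊗≫ c ◁ l ◁ τ ▷ U ⊗≫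
          (β ▷ (p ≫ U) ≫ b ◁ σ.inv) ⊗≫ 𝟙 _ := by bicategory
    _ = 𝟙 _ ⊗≫ c ◁ (γ ▷ 𝟙 _ ≫ (l ≫ q) ◁ adj'.unit) ⊗≫ c ◁ l ◁ τ ▷ U ⊗≫
          ((c ≫ l ≫ f) ◁ σ.inv ≫ β ▷ (u ≫ q)) ⊗≫ 𝟙 _ := by
      rw [whisker_exchange, whisker_exchange]
    _ = 𝟙 _ ⊗≫ c ◁ γ ⊗≫ (c ≫ l) ◁ ((ρ_ q).inv ≫ q ◁ adj'.unit ≫ (α_ q F U).inv ≫ τ ▷ U ≫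
          (α_ f p U).hom) ⊗≫ (c ≫ l ≫ f) ◁ σ.inv ⊗≫ β ▷ (u ≫ q) ⊗≫ 𝟙 _ := by bicategory
    -- Compatibility `h` produces the unit of `f ⊣ u` followed by `σ.hom`, which cancels the `σ.inv`
    -- contributed by `e₂`.
    _ = 𝟙 _ ⊗≫ c ◁ γ ⊗≫ (c ≫ l) ◁ (adj.unit ▷ q) ⊗≫ (c ≫ l ≫ f) ◁ (σ.hom ≫ σ.inv) ⊗≫
          β ▷ (u ≫ q) ⊗≫ 𝟙 _ := by
      rw [h]; bicategory
    _ = _ := by rw [Iso.hom_inv_id]; bicategory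

end LiftingAdjunction

/-! ### Whiskering in a strict 2-category, up to heterogeneous equality -/

section StrictWhiskering

variable {K : Type u} [Bicategory.{w, v} K] {a b c d : K}

theorem whiskerLeft_heq {f f' : a ⟶ b} (hf : f = f') {g h g' h' : b ⟶ c} (hg : g = g')
    (hh : h = h') {θ : g ⟶ h} {θ' : g' ⟶ h'} (hθ : θ ≍ θ') : f ◁ θ ≍ f' ◁ θ' := by
  subst hf hg hh; cases hθ; rfl

theorem whiskerRight_heq {f f' : b ⟶ c} (hf : f = f') {g h g' h' : a ⟶ b} (hg : g = g')
    (hh : h = h') {θ : g ⟶ h} {θ' : g' ⟶ h'} (hθ : θ ≍ θ') : θ ▷ f ≍ θ' ▷ f' := by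
  subst hf hg hh; cases hθ; rfl

variable [Bicategory.Strict K]

/-- In a strict bicategory the associators are `eqToHom`s, which heterogeneous equality absorbs. The
whiskering laws thus lose their coherence cells and can be chained across merely propositional
equalities of 1-cells. -/
theorem comp_whiskerLeft_heq (f : a ⟶ b) (g : b ⟶ c) {h h' : c ⟶ d} (θ : h ⟶ h') :
    (f ≫ g) ◁ θ ≍ f ◁ g ◁ θ := by
  rw [comp_whiskerLeft]; simp [Strict.associator_eqToIso]

theorem whiskerRight_comp_heq {f f' : a ⟶ b} (θ : f ⟶ f') (g : b ⟶ c) (h : c ⟶ d) :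
    θ ▷ (g ≫ h) ≍ θ ▷ g ▷ h := by
  rw [whiskerRight_comp]; simp [Strict.associator_eqToIso]

theorem whisker_assoc_heq (f : a ⟶ b) {g g' : b ⟶ c} (θ : g ⟶ g') (h : c ⟶ d) :
    (f ◁ θ) ▷ h ≍ f ◁ θ ▷ h := by
  rw [whisker_assoc]; simp [Strict.associator_eqToIso]

theorem eqToHom_heq_eqToHom {f g f' g' : a ⟶ b} (h : f = g) (h' : f' = g') (e : f = f') :
    eqToHom h ≍ eqToHom h' := by
  subst h h' e; rfl

end StrictWhiskering

/-! ### 2-cells into products and the action of `- × J` on them -/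

namespace CartesianTwoCategory

variable {K : Type u} [Bicategory.{w, v} K] [Bicategory.Strict K] [CartesianTwoCategory K]

theorem prod_hom_ext₂ {X A B : K} {h k : X ⟶ prod A B} {θ θ' : h ⟶ k}
    (h₁ : θ ▷ fst A B = θ' ▷ fst A B) (h₂ : θ ▷ snd A B = θ' ▷ snd A B) : θ = θ' :=
  (pair₂_bijective h k).1 (Prod.ext h₁ h₂)

/-- The endpoints are allowed to differ propositionally because `- × J` preserves composites only by
the proved equation `prodMap_comp`. -/
theorem prod_hom_ext₂_heq {X A B : K} {h k h' k' : X ⟶ prod A B} (eh : h = h') (ek : k = k')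
    {θ : h ⟶ k} {θ' : h' ⟶ k'}
    (h₁ : θ ▷ fst A B ≍ θ' ▷ fst A B) (h₂ : θ ▷ snd A B ≍ θ' ▷ snd A B) : θ ≍ θ' := by
  subst eh ek
  exact heq_of_eq (prod_hom_ext₂ (eq_of_heq h₁) (eq_of_heq h₂))

theorem prodMap₂_fst_heq {X Y : K} {h k : X ⟶ Y} (θ : h ⟶ k) (J : K) :
    prodMap₂ θ J ▷ fst Y J ≍ fst X J ◁ θ := by
  rw [prodMap₂_fst]; simp

theorem prodMap₂_snd_heq {X Y : K} {h k : X ⟶ Y} (θ : h ⟶ k) (J : K) :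
    prodMap₂ θ J ▷ snd Y J ≍ 𝟙 (snd X J) := by
  rw [prodMap₂_snd]
  exact eqToHom_heq_eqToHom _ rfl (prodMap_snd h J)

theorem prodMap₂_comp {X Y : K} {h k l : X ⟶ Y} (θ : h ⟶ k) (θ' : k ⟶ l) (J : K) :
    prodMap₂ (θ ≫ θ') J = prodMap₂ θ J ≫ prodMap₂ θ' J := by
  apply prod_hom_ext₂
  · simp [prodMap₂_fst]
  · simp [prodMap₂_snd]

theorem prodMap₂_eqToHom {X Y : K} {h k : X ⟶ Y} (e : h = k) (J : K) :
    prodMap₂ (eqToHom e) J = eqToHom (by rw [e]) := by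
  apply prod_hom_ext₂
  · simp [prodMap₂_fst]
  · simp [prodMap₂_snd]

end CartesianTwoCategory

/-! ### The product 2-functor and transposition of 2-cells -/

namespace CartesianClosedTwoCategory

open CartesianTwoCategory

variable {K : Type u} [Bicategory.{w, v} K] [Bicategory.Strict K] [CartesianClosedTwoCategory K]

theorem prodMap_id (X J : K) : prodMap (𝟙 X) J = 𝟙 (prod X J) := by
  apply prod_hom_ext
  · rw [prodMap_fst, Strict.comp_id, Strict.id_comp]
  · rw [prodMap_snd, Strict.id_comp]

/-- Compared on projections: after `fst` both sides become `(fst X J ≫ f) ◁ θ`, after `snd` both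
become an identity. -/
theorem prodMap₂_whiskerLeft_heq {X Y Z : K} (f : X ⟶ Y) {h k : Y ⟶ Z} (θ : h ⟶ k) (J : K) :
    prodMap₂ (f ◁ θ) J ≍ prodMap f J ◁ prodMap₂ θ J := by
  refine prod_hom_ext₂_heq (prodMap_comp _ _ _) (prodMap_comp _ _ _) ?_ ?_
  · refine (prodMap₂_fst_heq _ _).trans ?_
    refine HEq.trans ?_ (whisker_assoc_heq _ _ _).symm
    refine HEq.trans ?_ (whiskerLeft_heq rfl (prodMap_fst _ _) (prodMap_fst _ _)
      (prodMap₂_fst_heq _ _)).symm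
    refine (comp_whiskerLeft_heq _ _ _).symm.trans ?_
    refine HEq.trans ?_ (comp_whiskerLeft_heq _ _ _)
    rw [prodMap_fst]
  · refine (prodMap₂_snd_heq _ _).trans ?_
    refine HEq.trans ?_ (whisker_assoc_heq _ _ _).symm
    refine HEq.trans ?_ (whiskerLeft_heq rfl (prodMap_snd _ _) (prodMap_snd _ _)
      (prodMap₂_snd_heq _ _)).symm
    rw [whiskerLeft_id, prodMap_snd]

theorem prodMap₂_whiskerRight_heq {X Y Z : K} {h k : X ⟶ Y} (θ : h ⟶ k) (g : Y ⟶ Z) (J : K) :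
    prodMap₂ (θ ▷ g) J ≍ prodMap₂ θ J ▷ prodMap g J := by
  refine prod_hom_ext₂_heq (prodMap_comp _ _ _) (prodMap_comp _ _ _) ?_ ?_
  · refine (prodMap₂_fst_heq _ _).trans ?_
    refine HEq.trans ?_ (whiskerRight_comp_heq _ _ _)
    rw [prodMap_fst]
    refine HEq.trans ?_ (whiskerRight_comp_heq _ _ _).symm
    refine HEq.trans ?_ (whiskerRight_heq rfl (prodMap_fst _ _) (prodMap_fst _ _)
      (prodMap₂_fst_heq _ _)).symm
    exact (whisker_assoc_heq _ _ _).symm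
  · refine (prodMap₂_snd_heq _ _).trans ?_
    refine HEq.trans ?_ (whiskerRight_comp_heq _ _ _)
    rw [prodMap_snd]
    exact (prodMap₂_snd_heq _ _).symm

/-- The transpose `h × J ≫ ev ⟶ k × J ≫ ev` of a 2-cell `h ⟶ k` between 1-cells into `A^J`. -/
noncomputable def uncurry₂ {X J A : K} {h k : X ⟶ exp J A} (θ : h ⟶ k) :
    prodMap h J ≫ ev J A ⟶ prodMap k J ≫ ev J A :=
  prodMap₂ θ J ▷ ev J A

/-- Two-dimensional uniqueness for exponentials: equations between 2-cells into `A^J` can be checked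
after transposition. -/
theorem exp_hom_ext₂_heq {X J A : K} {h k h' k' : X ⟶ exp J A} (eh : h = h') (ek : k = k')
    {θ : h ⟶ k} {θ' : h' ⟶ k'} (e : uncurry₂ θ ≍ uncurry₂ θ') : θ ≍ θ' := by
  subst eh ek
  exact heq_of_eq ((curry₂_bijective h k).1 (eq_of_heq e))

theorem uncurry₂_comp {X J A : K} {h k l : X ⟶ exp J A} (θ : h ⟶ k) (θ' : k ⟶ l) :
    uncurry₂ (θ ≫ θ') = uncurry₂ θ ≫ uncurry₂ θ' := by
  rw [uncurry₂, prodMap₂_comp, comp_whiskerRight]; rfl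

theorem uncurry₂_eqToHom {X J A : K} {h k : X ⟶ exp J A} (e : h = k) :
    uncurry₂ (eqToHom e) = eqToHom (by rw [e]) := by
  rw [uncurry₂, prodMap₂_eqToHom, eqToHom_whiskerRight]

theorem uncurry₂_whiskerLeft_heq {X Y J A : K} (f : X ⟶ Y) {h k : Y ⟶ exp J A} (θ : h ⟶ k) :
    uncurry₂ (f ◁ θ) ≍ prodMap f J ◁ uncurry₂ θ :=
  (whiskerRight_heq rfl (prodMap_comp _ _ _) (prodMap_comp _ _ _)
    (prodMap₂_whiskerLeft_heq f θ J)).trans (whisker_assoc_heq _ _ _)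

theorem uncurry₂_whiskerRight_heq {X Y J A : K} {h k : X ⟶ Y} (θ : h ⟶ k) (g : Y ⟶ exp J A) :
    uncurry₂ (θ ▷ g) ≍ prodMap₂ θ J ▷ (prodMap g J ≫ ev J A) :=
  (whiskerRight_heq rfl (prodMap_comp _ _ _) (prodMap_comp _ _ _)
    (prodMap₂_whiskerRight_heq θ g J)).trans (whiskerRight_comp_heq _ _ _).symm

/-! ### Exponentiation by `J` as a 2-functor -/

theorem prodMap_expMap_ev {A B : K} (u : A ⟶ B) (J : K) :
    prodMap (expMap u J) J ≫ ev J B = ev J A ≫ u :=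
  prodMap_curry_ev _

theorem prodMap_constDiagram_ev (A J : K) : prodMap (constDiagram A J) J ≫ ev J A = fst A J := by
  rw [constDiagram_eq, prodMap_curry_ev]

theorem expMap_id (A J : K) : expMap (𝟙 A) J = 𝟙 (exp J A) := by
  apply exp_hom_ext
  rw [prodMap_expMap_ev, prodMap_id, Strict.comp_id, Strict.id_comp]

theorem expMap_comp {A B C : K} (u : A ⟶ B) (v : B ⟶ C) (J : K) :
    expMap (u ≫ v) J = expMap u J ≫ expMap v J := by
  apply exp_hom_ext
  rw [prodMap_expMap_ev, prodMap_comp, Strict.assoc, prodMap_expMap_ev, ← Strict.assoc,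
    ← Strict.assoc, prodMap_expMap_ev]

/-- Exponentiation of a 2-cell `θ : u ⟶ v` by `J`: the 2-cell `θ^J : u^J ⟶ v^J`. -/
noncomputable def expMap₂ {A B : K} {u v : A ⟶ B} (θ : u ⟶ v) (J : K) :
    expMap u J ⟶ expMap v J :=
  ((curry₂_bijective _ _).2 (eqToHom (prodMap_expMap_ev u J) ≫ ev J A ◁ θ ≫
    eqToHom (prodMap_expMap_ev v J).symm)).choose

theorem uncurry₂_expMap₂ {A B : K} {u v : A ⟶ B} (θ : u ⟶ v) (J : K) :
    uncurry₂ (expMap₂ θ J) = eqToHom (prodMap_expMap_ev u J) ≫ ev J A ◁ θ ≫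
      eqToHom (prodMap_expMap_ev v J).symm :=
  ((curry₂_bijective _ _).2 (eqToHom (prodMap_expMap_ev u J) ≫ ev J A ◁ θ ≫
    eqToHom (prodMap_expMap_ev v J).symm)).choose_spec

theorem uncurry₂_expMap₂_heq {A B : K} {u v : A ⟶ B} (θ : u ⟶ v) (J : K) :
    uncurry₂ (expMap₂ θ J) ≍ ev J A ◁ θ := by
  rw [uncurry₂_expMap₂]; simp

theorem expMap₂_comp {A B : K} {u v w : A ⟶ B} (θ : u ⟶ v) (θ' : v ⟶ w) (J : K) :
    expMap₂ (θ ≫ θ') J = expMap₂ θ J ≫ expMap₂ θ' J := by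
  apply (curry₂_bijective _ _).1
  change uncurry₂ _ = uncurry₂ _
  simp [uncurry₂_comp, uncurry₂_expMap₂]

theorem expMap₂_eqToHom {A B : K} {u v : A ⟶ B} (e : u = v) (J : K) :
    expMap₂ (eqToHom e) J = eqToHom (by rw [e]) := by
  apply (curry₂_bijective _ _).1
  change uncurry₂ _ = uncurry₂ _
  simp [uncurry₂_eqToHom, uncurry₂_expMap₂]

/-- Both transposes are `(ev J A ≫ u) ◁ θ`. -/
theorem expMap₂_whiskerLeft_heq {A B C : K} (u : A ⟶ B) {v w : B ⟶ C} (θ : v ⟶ w) (J : K) :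
    expMap₂ (u ◁ θ) J ≍ expMap u J ◁ expMap₂ θ J := by
  refine exp_hom_ext₂_heq (expMap_comp _ _ _) (expMap_comp _ _ _) ?_
  refine (uncurry₂_expMap₂_heq _ _).trans ?_
  refine HEq.trans ?_ (uncurry₂_whiskerLeft_heq _ _).symm
  refine HEq.trans ?_ (whiskerLeft_heq rfl (prodMap_expMap_ev _ _) (prodMap_expMap_ev _ _)
    (uncurry₂_expMap₂_heq _ _)).symm
  refine (comp_whiskerLeft_heq _ _ _).symm.trans ?_
  refine HEq.trans ?_ (comp_whiskerLeft_heq _ _ _)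
  rw [prodMap_expMap_ev]

/-- Both transposes are `(ev J A ◁ θ) ▷ w`. -/
theorem expMap₂_whiskerRight_heq {A B C : K} {u v : A ⟶ B} (θ : u ⟶ v) (w : B ⟶ C) (J : K) :
    expMap₂ (θ ▷ w) J ≍ expMap₂ θ J ▷ expMap w J := by
  refine exp_hom_ext₂_heq (expMap_comp _ _ _) (expMap_comp _ _ _) ?_
  refine (uncurry₂_expMap₂_heq _ _).trans ?_
  refine HEq.trans ?_ (uncurry₂_whiskerRight_heq _ _).symm
  rw [prodMap_expMap_ev]
  refine HEq.trans ?_ (whiskerRight_comp_heq _ _ _).symm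
  refine HEq.trans ?_ (whiskerRight_heq rfl (prodMap_expMap_ev _ _) (prodMap_expMap_ev _ _)
    (uncurry₂_expMap₂_heq _ _)).symm
  exact (whisker_assoc_heq _ _ _).symm

/-- Naturality of `Δ` with respect to 2-cells: `θ^J Δ = Δ θ`. -/
theorem constDiagram_whiskerLeft_expMap₂_heq {A B : K} {u v : A ⟶ B} (θ : u ⟶ v) (J : K) :
    constDiagram A J ◁ expMap₂ θ J ≍ θ ▷ constDiagram B J := by
  refine exp_hom_ext₂_heq (comp_constDiagram _ _).symm (comp_constDiagram _ _).symm ?_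
  refine (uncurry₂_whiskerLeft_heq _ _).trans ?_
  refine HEq.trans ?_ (uncurry₂_whiskerRight_heq _ _).symm
  refine (whiskerLeft_heq rfl (prodMap_expMap_ev _ _) (prodMap_expMap_ev _ _)
    (uncurry₂_expMap₂_heq _ _)).trans ?_
  refine (comp_whiskerLeft_heq _ _ _).symm.trans ?_
  -- `Δ` transposes to the projection, so what remains is `fst A J ◁ θ` against `prodMap₂ θ J ▷ fst
  -- B J`: the defining property of `θ × J`.
  rw [prodMap_constDiagram_ev, prodMap_constDiagram_ev]
  exact (prodMap₂_fst_heq _ _).symm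

/-- The conjugated form is an honest equation, usable as a rewriting rule in the triangle
identities. -/
theorem expMap₂_whiskerLeft {A B C : K} (u : A ⟶ B) {v w : B ⟶ C} (θ : v ⟶ w) (J : K) :
    expMap₂ (u ◁ θ) J = eqToHom (expMap_comp u v J) ≫ expMap u J ◁ expMap₂ θ J ≫
      eqToHom (expMap_comp u w J).symm :=
  (conj_eqToHom_iff_heq' _ _ _ _).2 (expMap₂_whiskerLeft_heq u θ J)

theorem expMap₂_whiskerRight {A B C : K} {u v : A ⟶ B} (θ : u ⟶ v) (w : B ⟶ C) (J : K) :
    expMap₂ (θ ▷ w) J = eqToHom (expMap_comp u w J) ≫ expMap₂ θ J ▷ expMap w J ≫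
      eqToHom (expMap_comp v w J).symm :=
  (conj_eqToHom_iff_heq' _ _ _ _).2 (expMap₂_whiskerRight_heq θ w J)

/-- Exponentiation by `J` carries an adjunction `f ⊣ u` to an adjunction `f^J ⊣ u^J`. -/
noncomputable def expAdjunction {A B : K} {f : B ⟶ A} {u : A ⟶ B} (adj : f ⊣ u) (J : K) :
    expMap f J ⊣ expMap u J where
  unit := eqToHom (expMap_id B J).symm ≫ expMap₂ adj.unit J ≫ eqToHom (expMap_comp f u J)
  counit := eqToHom (expMap_comp u f J).symm ≫ expMap₂ adj.counit J ≫ eqToHom (expMap_id A J)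
  left_triangle := by
    -- `(-)^J` is applied to the triangle identity of `adj`; the outer `eqToHom`s adjust the
    -- endpoints, since `(𝟙 B ≫ f)^J` and `𝟙 (B^J) ≫ f^J` are equal only propositionally.
    have h := congrArg (fun θ => eqToHom (by rw [expMap_comp, expMap_id]) ≫ expMap₂ θ J ≫
      eqToHom (by rw [expMap_comp, expMap_id])) adj.left_triangle
    simpa [leftZigzag, bicategoricalComp, Strict.associator_eqToIso,
      Strict.leftUnitor_eqToIso, Strict.rightUnitor_eqToIso, expMap₂_comp, expMap₂_eqToHom,
      expMap₂_whiskerLeft, expMap₂_whiskerRight] using h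
  right_triangle := by
    have h := congrArg (fun θ => eqToHom (by rw [expMap_comp, expMap_id]) ≫ expMap₂ θ J ≫
      eqToHom (by rw [expMap_comp, expMap_id])) adj.right_triangle
    simpa [rightZigzag, bicategoricalComp, Strict.associator_eqToIso,
      Strict.leftUnitor_eqToIso, Strict.rightUnitor_eqToIso, expMap₂_comp, expMap₂_eqToHom,
      expMap₂_whiskerLeft, expMap₂_whiskerRight] using h

/-! ### Preservation of limits and colimits -/

theorem constDiagram_whiskerLeft_expMap₂ {A B : K} {u v : A ⟶ B} (θ : u ⟶ v) (J : K) :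
    constDiagram A J ◁ expMap₂ θ J = eqToHom (comp_constDiagram u J).symm ≫
      θ ▷ constDiagram B J ≫ eqToHom (comp_constDiagram v J) :=
  (conj_eqToHom_iff_heq' _ _ _ _).2 (constDiagram_whiskerLeft_expMap₂_heq θ J)

/-- Right adjoints preserve limits. -/
theorem preservesLimitCones_of_adjunction {A B : K} {f : B ⟶ A} {u : A ⟶ B} (adj : f ⊣ u) :
    PreservesLimitCones u := by
  intro J d l lam hl
  -- Both squares are the equality `u^J Δ = Δu`, for `u` and for `f`; with this `σ` the pasted cone
  -- is `mapCone u lam` by definition.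
  refine IsAbsoluteRightLifting.map_rightAdjoint adj (expAdjunction adj J)
    (eqToHom (comp_constDiagram u J)) (eqToIso (comp_constDiagram f J)) ?_ hl
  -- With equality squares, compatibility says exactly `ε^J Δ = Δε`.
  simp [expAdjunction, constDiagram_whiskerLeft_expMap₂, Strict.associator_eqToIso,
    Strict.leftUnitor_eqToIso, Strict.rightUnitor_eqToIso]

/-- Left adjoints preserve colimits. -/
theorem preservesColimitCones_of_adjunction {A B : K} {f : B ⟶ A} {u : A ⟶ B} (adj : f ⊣ u) :
    PreservesColimitCones f := by
  intro J d c γ hc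
  refine IsAbsoluteLeftLifting.map_leftAdjoint adj (expAdjunction adj J)
    (eqToIso (comp_constDiagram u J)) (eqToHom (comp_constDiagram f J).symm) ?_ hc
  -- Here compatibility is `η^J Δ = Δη`.
  simp [expAdjunction, constDiagram_whiskerLeft_expMap₂, Strict.associator_eqToIso,
    Strict.leftUnitor_eqToIso, Strict.rightUnitor_eqToIso]

end CartesianClosedTwoCategory

theorem mainTheorem1 :
    (∀ (K : Type u) [Bicategory.{w, v} K] [Bicategory.Strict K] [CartesianClosedTwoCategory K]
      {A B : K} (f : B ⟶ A) (u : A ⟶ B), (f ⊣ u) →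
        CartesianClosedTwoCategory.PreservesLimitCones u ∧
          CartesianClosedTwoCategory.PreservesColimitCones f) ∧
    (∀ {A B : InftyCat.{t}} (f : B ⟶ A) (u : A ⟶ B), (f ⊣ u) →
        CartesianClosedTwoCategory.PreservesLimitCones u ∧
          CartesianClosedTwoCategory.PreservesColimitCones f) := by
  -- The statement for `InftyCat` is the general one, applied to its cartesian closed structure.
  refine ⟨fun K _ _ _ A B f u adj => ?_, fun f u adj => ?_⟩ <;>
    exact ⟨CartesianClosedTwoCategory.preservesLimitCones_of_adjunction adj,
      CartesianClosedTwoCategory.preservesColimitCones_of_adjunction adj⟩
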